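/- A \emph{labeled oriented tree} (LOT) $\mathcal P$ is a finite oriented graph that is a tree and whose oriented edges are labeled by its vertices. The \emph{LOT presentation} $P$ of $\mathcal P$ has the vertices of $\mathcal P$ as generators and, for every edge from $u_1$ to $u_2$ with label $u_3$, the (not necessarily reduced) relator $u_1u_3(u_3u_2)^{-1}=u_1u_3u_2^{-1}u_3^{-1}$. A \emph{reorientation} of $\mathcal P$ is a LOT obtained from $\mathcal P$ by changing the orientations of some (possibly none) of its edges, the labels being kept. For a presentation $P$, let $K(P)$ be the 2-complex with one vertex, one oriented edge for each generator, and one 2-cell for each relator $r$, attached along the word $r$. A \emph{spherical diagram} over $K(P)$ is a combinatorial map $f\colon C\to K(P)$ (open cells are mapped homeomorphically to open cells), where $C$ is a 2-sphere with a cell structure; the label of an edge $e$ of $C$ is the generator corresponding to $f(e)$. An edge $e$ of $C$ is a \emph{folding edge} if the two 2-cells of $C$ on the two sides of $e$ are mapped by $f$ to the same 2-cell of $K(P)$ with opposite orientations by folding over $e$. For a set $S$ of generators, $P$ is \emph{DR (diagrammatically reducible) directed away from $S$} if every spherical diagram over $K(P)$ that contains an edge with label not in $S$ also contains a folding edge with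 label not in $S$. \textbf{Theorem.} Every labeled oriented tree $\mathcal P$ has a reorientation $\mathcal P'$ such that the LOT presentation $P'$ of $\mathcal P'$ is DR directed away from $\{x\}$ for every generator $x$ of $P'$. -/

import Mathlib

/-- A group presentation with generators `X` and relators indexed by `R`. A relator is a (not
necessarily reduced) word, i.e. a list of letters `(x, true) = x` and `(x, false) = x⁻¹`; relators
form a family, so the same word may occur several times. -/
structure GroupPres (X : Type*) (R : Type*) where
  rel : R → List (X × Bool)

/-- The inverse of a letter. -/
def invLetter {X : Type*} (a : X × Bool) : X × Bool := (a.1, !a.2)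

namespace GroupPres

variable {X R : Type*} (P : GroupPres X R)

/-- The 2-complex `K(P)` has one vertex, one oriented edge for each generator, and for each relator
`r` a polygon `Δ(r)` attached along the word `r`. `P.Side` is the set of the sides of these
polygons: `⟨r, i⟩` is the side of `Δ(r)` which is attached along the `i`-th letter of `r`. -/
def Side : Type _ := Σ r : R, Fin (P.rel r).length

variable {P} in
/-- The letter along which a side of a polygon is attached. -/
def Side.letter (s : P.Side) : X × Bool := (P.rel s.1).get s.2

variable {P} in
/-- The side that follows `s` (cyclically) on the boundary of its polygon. -/
def Side.next (s : P.Side) : P.Side := ⟨s.1, finRotate _ s.2⟩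

end GroupPres

/-- The number of orbits (fixed points included) of a permutation. -/
noncomputable def numOrbits {D : Type*} (π : Equiv.Perm D) : ℕ :=
  Nat.card (Quotient (Equiv.Perm.SameCycle.setoid π))

/-- A cell structure with at least one edge on the oriented 2-sphere, as a combinatorial map
(rotation system). `D` is the set of oriented edges; `rev` reverses the orientation of an edge;
`next d` is the oriented edge that follows `d` on the boundary of the 2-cell to the left of `d`.
So the edges are the orbits of `rev`, the 2-cells are the orbits of `next`, and the vertices are
the orbits of `rev` followed by `next`, which permutes the oriented edges starting at a vertex. The
surface is a 2-sphere: it is connected and has Euler characteristic `2`. -/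
structure SphereCells (D : Type*) where
  rev : Equiv.Perm D
  next : Equiv.Perm D
  rev_rev : ∀ d, rev (rev d) = d
  rev_ne : ∀ d, rev d ≠ d
  nonempty : Nonempty D
  connected : ∀ d d' : D, ∃ g ∈ Subgroup.closure {rev, next}, g d = d'
  euler : (numOrbits (next * rev) : ℤ) - numOrbits rev + numOrbits next = 2

/-- A spherical diagram `f : C → K(P)`, i.e. a combinatorial map to `K(P)` from a 2-sphere `C` with
a cell structure. The map `f` takes the 2-cell to the left of `d` homeomorphically to the 2-cell of
`K(P)` that carries `side d`, and the oriented edge `d` on the boundary of that 2-cell to `side d`.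
`pos d` says whether `f` preserves (`true`) or reverses (`false`) the orientation of that 2-cell. -/
structure SphericalDiagram {X R : Type*} (P : GroupPres X R) (D : Type*) extends SphereCells D where
  side : D → P.Side
  pos : D → Bool
  pos_next : ∀ d, pos (next d) = pos d
  side_next_of_pos : ∀ d, pos d = true → side (next d) = (side d).next
  side_next_of_neg : ∀ d, pos d = false → (side (next d)).next = side d
  /-- a 2-cell has as many sides as its image: no winding several times around `Δ(r)` -/
  side_inj : ∀ d d', next.SameCycle d d' → side d = side d' → d = d'
  /-- the two 2-cells at an edge induce the same map on this edge: the letters that are read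
  along the oriented edges `d` and `rev d` are inverse to each other -/
  letter_rev : ∀ d,
    (if pos (rev d) then (side (rev d)).letter else invLetter (side (rev d)).letter) =
      invLetter (if pos d then (side d).letter else invLetter (side d).letter)

namespace SphericalDiagram

variable {X R : Type*} {P : GroupPres X R} {D : Type*} (C : SphericalDiagram P D)

/-- The generator that labels the edge underlying the oriented edge `d`. -/
def label (d : D) : X := (C.side d).letter.1

/-- The edge underlying `d` is a folding edge: the 2-cells on its two sides are mapped to the same
2-cell of `K(P)`, with opposite orientations, and they are mirror images of each other in the edge
(so the edge is the same side of the polygon for both of them). -/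
def IsFoldingEdge (d : D) : Prop :=
  C.side (C.rev d) = C.side d ∧ C.pos (C.rev d) ≠ C.pos d

end SphericalDiagram

/-- `P` is diagrammatically reducible (DR) directed away from the set `S` of generators: each
spherical diagram over `K(P)` that contains an edge with label not from `S` contains a folding edge
with label not from `S`. -/
def GroupPres.DRAwayFrom {X R : Type*} (P : GroupPres X R) (S : Set X) : Prop :=
  ∀ (D : Type) [Finite D] (C : SphericalDiagram P D),
    (∃ d, C.label d ∉ S) → ∃ d, C.IsFoldingEdge d ∧ C.label d ∉ S

/-- A labeled oriented tree (LOT) with vertex set `V` and edge set `E`: an oriented graph that is a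
tree, whose edges are labeled by vertices. -/
structure LOT (V E : Type*) where
  src : E → V
  tgt : E → V
  label : E → V
  src_ne_tgt : ∀ e, src e ≠ tgt e
  ends_injective : Function.Injective fun e => s(src e, tgt e)
  isTree : (SimpleGraph.fromEdgeSet (Set.range fun e => s(src e, tgt e))).IsTree

namespace LOT

variable {V E : Type*}

/-- The LOT presentation: the generators are the vertices, and each edge from `u₁` to `u₂` with
label `u₃` gives the relator `u₁ u₃ (u₃ u₂)⁻¹ = u₁ u₃ u₂⁻¹ u₃⁻¹`. -/
def presentation (T : LOT V E) : GroupPres V E where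
  rel e := [(T.src e, true), (T.label e, true), (T.tgt e, false), (T.label e, false)]

/-- `T'` is a reorientation of `T`: it arises from `T` by changing some edge orientations. -/
def IsReorientation (T' T : LOT V E) : Prop :=
  ∀ e, T'.label e = T.label e ∧
    (T'.src e = T.src e ∧ T'.tgt e = T.tgt e ∨ T'.src e = T.tgt e ∧ T'.tgt e = T.src e)

end LOT

/-! Call the graph on the generators with an edge from `src e` to `label e` for each `e` the left
graph. The proof has two halves.

Orientation: start from the tree itself and replace its edges, one at a time, by one of the other
two sides of the triangle on `src e`, `tgt e`, `label e`; one of the two choices keeps the graph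
connected (`exists_connected_update`). The result is the left graph of a reorientation; it has |V| -
1 edges, so it is a tree.

Folding: the letters of each relator have signs +, +, -, -, so the edge orientations of a spherical
diagram form a 1-cocycle. On a sphere it is the coboundary of a potential (`range_coboundary`), and
a lowest vertex is a source. Each corner there joins sides 3 and 0 of its polygon, hence is an edge
of the left graph, and the link of the source is a closed walk in a tree. Where this walk is
farthest from `x` it turns back along the same tree edge, which gives a folding edge whose label is
not `x`. -/

/-! ### Vanishing of the first cohomology of the sphere -/

section Cohomology

variable {D : Type*}

theorem apply_eq_of_mem_closure {α : Type*} {S : Set (Equiv.Perm D)} {f : D → α}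
    (hf : ∀ π ∈ S, ∀ d, f (π d) = f d) {g : Equiv.Perm D} (hg : g ∈ Subgroup.closure S) (d : D) :
    f (g d) = f d := by
  induction hg using Subgroup.closure_induction generalizing d with
  | mem π h => exact hf π h d
  | one => rfl
  | mul a b _ _ ha hb => rw [Equiv.Perm.mul_apply, ha, hb]
  | inv a _ ha => simpa using (ha (a⁻¹ d)).symm

theorem Equiv.Perm.SameCycle.apply_eq {α : Type*} {π : Equiv.Perm D} {f : D → α}
    (hf : ∀ d, f (π d) = f d) {d d' : D} (h : π.SameCycle d d') : f d' = f d := by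
  obtain ⟨i, rfl⟩ : ∃ i : ℤ, (π ^ i) d = d' := h
  refine apply_eq_of_mem_closure (S := {π}) ?_ ?_ d
  · rintro _ rfl
    exact hf
  · exact Subgroup.zpow_mem _ (Subgroup.subset_closure (Set.mem_singleton π)) i

/-- The real functions that are constant on the orbits of a permutation. -/
def invariantFunctions (π : Equiv.Perm D) : Submodule ℝ (EuclideanSpace ℝ D) where
  carrier := {f | ∀ d, f (π d) = f d}
  add_mem' hf hg d := by simp [hf d, hg d]
  zero_mem' d := by simp
  smul_mem' c f hf d := by simp [hf d]

theorem mem_invariantFunctions {π : Equiv.Perm D} {f : EuclideanSpace ℝ D} :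
    f ∈ invariantFunctions π ↔ ∀ d, f (π d) = f d := Iff.rfl

/-- Functions constant on orbits are functions on the set of orbits. -/
noncomputable def orbitFunctionsEquiv (π : Equiv.Perm D) :
    (Quotient (Equiv.Perm.SameCycle.setoid π) → ℝ) ≃ₗ[ℝ] invariantFunctions π where
  toFun g := ⟨WithLp.toLp 2 fun d => g (Quotient.mk _ d), fun d => congrArg g
    (Quotient.sound (s := Equiv.Perm.SameCycle.setoid π)
      (Equiv.Perm.sameCycle_apply_left.2 (Equiv.Perm.SameCycle.refl π d)))⟩
  map_add' _ _ := rfl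
  map_smul' _ _ := rfl
  invFun f := Quotient.lift (fun d => (f : EuclideanSpace ℝ D) d)
    fun _ _ h => (Equiv.Perm.SameCycle.apply_eq f.2 h).symm
  left_inv g := by
    ext q
    induction q using Quotient.inductionOn with
    | h d => rfl
  right_inv f := rfl

theorem finrank_invariantFunctions [Fintype D] (π : Equiv.Perm D) :
    Module.finrank ℝ (invariantFunctions π) = numOrbits π := by
  classical
  have : Fintype (Quotient (Equiv.Perm.SameCycle.setoid π)) := Fintype.ofFinite _
  rw [← (orbitFunctionsEquiv π).finrank_eq, Module.finrank_pi, numOrbits, Nat.card_eq_fintype_card]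

namespace SphereCells

variable (C : SphereCells D)

theorem card_le_two_mul_numOrbits [Fintype D] : Fintype.card D ≤ 2 * numOrbits C.rev := by
  have hsurj : Function.Surjective
      fun p : Bool × Quotient (Equiv.Perm.SameCycle.setoid C.rev) =>
        if p.1 then p.2.out else C.rev p.2.out := by
    intro d
    let q : Quotient (Equiv.Perm.SameCycle.setoid C.rev) := Quotient.mk _ d
    have h : C.rev.SameCycle q.out d :=
      Quotient.exact (s := Equiv.Perm.SameCycle.setoid C.rev) (Quotient.out_eq q)
    have hd : d = q.out ∨ d = C.rev q.out := by
      have := h.apply_eq (f := fun d => ({d, C.rev d} : Set D)) fun d => by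
        rw [C.rev_rev, Set.pair_comm]
      have hmem : d ∈ ({d, C.rev d} : Set D) := by simp
      rw [this] at hmem
      simpa using hmem
    rcases hd with hd | hd
    · exact ⟨(true, q), by simpa using hd.symm⟩
    · exact ⟨(false, q), by simpa using hd.symm⟩
  have := Nat.card_le_card_of_surjective _ hsurj
  rw [Nat.card_prod, Nat.card_eq_fintype_card, Nat.card_eq_fintype_card (α := Bool),
    Fintype.card_bool] at this
  exact this

theorem apply_eq_of_invariant {α : Type*} {f : D → α} (hr : ∀ d, f (C.rev d) = f d)
    (hn : ∀ d, f (C.next d) = f d) (d d' : D) : f d' = f d := by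
  obtain ⟨g, hg, rfl⟩ := C.connected d d'
  refine apply_eq_of_mem_closure ?_ hg d
  rintro π (rfl | rfl)
  exacts [hr, hn]

/-- By connectedness, such functions are constant. Used for the kernel of the coboundary and for the
relations between edge and 2-cell conditions. -/
theorem finrank_le_one_of_invariant (W : Submodule ℝ (EuclideanSpace ℝ D))
    (hr : ∀ f ∈ W, ∀ d, f (C.rev d) = f d) (hn : ∀ f ∈ W, ∀ d, f (C.next d) = f d) :
    Module.finrank ℝ W ≤ 1 := by
  obtain ⟨d₀⟩ := C.nonempty
  have hle : W ≤ ℝ ∙ (WithLp.toLp 2 fun _ => 1 : EuclideanSpace ℝ D) := by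
    intro f hf
    refine Submodule.mem_span_singleton.2 ⟨f d₀, ?_⟩
    ext d
    simp [C.apply_eq_of_invariant (hr f hf) (hn f hf) d₀ d]
  exact (Submodule.finrank_mono hle).trans ((finrank_span_le_card _).trans (by simp))

variable [Fintype D]

/-- The coboundary of a function on the vertices. -/
noncomputable def coboundary :
    invariantFunctions (C.next * C.rev) →ₗ[ℝ] EuclideanSpace ℝ D where
  toFun f := WithLp.toLp 2 fun d => (f : EuclideanSpace ℝ D) (C.rev d) - (f : EuclideanSpace ℝ D) d
  map_add' f g := by ext d; simp; ring
  map_smul' c f := by ext d; simp; ring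

/-- The space of cocycles: antisymmetric functions whose sum over each 2-cell vanishes. -/
noncomputable def cocycles : Submodule ℝ (EuclideanSpace ℝ D) :=
  (invariantFunctions C.rev ⊔ invariantFunctions C.next)ᗮ

variable {C}

/-- The primitive `η` may differ from one 2-cell to another: the sum around each 2-cell telescopes.
-/
theorem mem_cocycles_of_antisymm {ε : EuclideanSpace ℝ D} (hε : ∀ d, ε (C.rev d) = - ε d)
    {η : D → ℝ} (hη : ∀ d, ε d = η (C.next d) - η d) : ε ∈ C.cocycles := by
  rw [cocycles, ← Submodule.inf_orthogonal]
  refine ⟨(Submodule.mem_orthogonal _ _).2 fun g hg => ?_,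
    (Submodule.mem_orthogonal _ _).2 fun g hg => ?_⟩ <;>
    rw [mem_invariantFunctions] at hg <;> rw [PiLp.inner_apply]
  · have h := Equiv.sum_comp C.rev fun d => inner ℝ (g d) (ε d)
    simp only [hg, hε, inner_neg_right, Finset.sum_neg_distrib] at h
    linarith
  · have h := Equiv.sum_comp C.next fun d => g d * η d
    simp only [hg] at h
    simp only [hη, inner_sub_right, Finset.sum_sub_distrib]
    simp only [RCLike.inner_apply, conj_trivial]
    simp only [mul_comm, h, sub_self] at *

variable (C)

/-- A dimension count, with v, e, f the numbers of vertices, edges and 2-cells: the range has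
dimension at least v - 1, the cocycles at most 2e - (e + f - 1), and these bounds agree by Euler's
formula. -/
theorem range_coboundary : LinearMap.range C.coboundary = C.cocycles := by
  refine Submodule.eq_of_le_of_finrank_le ?_ ?_
  · rintro _ ⟨f, rfl⟩
    refine mem_cocycles_of_antisymm (η := fun d => (f : EuclideanSpace ℝ D) d) ?_ ?_ <;> intro d
    · simp [coboundary, C.rev_rev]
    · have := f.2 (C.rev d)
      rw [Equiv.Perm.mul_apply, C.rev_rev] at this
      simp [coboundary, this]
  · have hker : Module.finrank ℝ (LinearMap.ker C.coboundary) ≤ 1 := by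
      have hr : ∀ f ∈ LinearMap.ker C.coboundary, ∀ d,
          (f : EuclideanSpace ℝ D) (C.rev d) = (f : EuclideanSpace ℝ D) d := fun f hf d =>
        sub_eq_zero.1 (congrArg (fun g : EuclideanSpace ℝ D => g d) (LinearMap.mem_ker.1 hf))
      rw [← Submodule.finrank_map_subtype_eq]
      refine C.finrank_le_one_of_invariant _ ?_ ?_
      · rintro _ ⟨f, hf, rfl⟩
        exact hr f hf
      · rintro _ ⟨f, hf, rfl⟩ d
        have := f.2 (C.rev d)
        rw [Equiv.Perm.mul_apply, C.rev_rev] at this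
        exact this.trans (hr f hf d)
    have hinf : Module.finrank ℝ
        (invariantFunctions C.rev ⊓ invariantFunctions C.next : Submodule ℝ _) ≤ 1 :=
      C.finrank_le_one_of_invariant _ (fun _ hf => hf.1) (fun _ hf => hf.2)
    have h₁ := LinearMap.finrank_range_add_finrank_ker C.coboundary
    have h₂ := Submodule.finrank_sup_add_finrank_inf_eq
      (invariantFunctions C.rev) (invariantFunctions C.next)
    have h₃ := Submodule.finrank_add_finrank_orthogonal
      (invariantFunctions C.rev ⊔ invariantFunctions C.next)
    have h₄ := C.card_le_two_mul_numOrbits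
    have h₅ := C.euler
    rw [finrank_invariantFunctions] at h₁
    rw [finrank_invariantFunctions, finrank_invariantFunctions] at h₂
    rw [finrank_euclideanSpace] at h₃
    rw [cocycles]
    omega

/-- The first cohomology of the 2-sphere vanishes, so that a cocycle without zeros which takes
opposite signs on opposite edges has a source: a vertex all of whose edges are positive. -/
theorem exists_source (ε η : D → ℝ) (hε : ∀ d, ε (C.rev d) = - ε d)
    (hη : ∀ d, ε d = η (C.next d) - η d) :
    ∃ d, ∀ d', (C.next * C.rev).SameCycle d d' → 0 ≤ ε d' := by
  have hmem : (WithLp.toLp 2 ε : EuclideanSpace ℝ D) ∈ LinearMap.range C.coboundary := by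
    rw [range_coboundary]
    exact mem_cocycles_of_antisymm hε hη
  obtain ⟨f, hf⟩ := hmem
  have := C.nonempty
  -- `f` is a potential for `ε`; no edge descends from its lowest vertex.
  obtain ⟨d, hd⟩ := Finite.exists_min fun d => (f : EuclideanSpace ℝ D) d
  refine ⟨d, fun d' h => ?_⟩
  have h₁ : (f : EuclideanSpace ℝ D) (C.rev d') - (f : EuclideanSpace ℝ D) d' = ε d' :=
    congrArg (fun g : EuclideanSpace ℝ D => g d') hf
  have h₂ : (f : EuclideanSpace ℝ D) d' = (f : EuclideanSpace ℝ D) d :=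
    Equiv.Perm.SameCycle.apply_eq (f := fun d => (f : EuclideanSpace ℝ D) d) f.2 h
  have h₃ := hd (C.rev d')
  rw [← h₁, h₂]
  exact sub_nonneg.2 h₃

end SphereCells

end Cohomology

/-! ### Connected edge families and trees -/

section EdgeFamily

variable {V E : Type*}

/-- The simple graph underlying a family of edges (which may be loops or parallel). -/
def familyGraph (f : E → Sym2 V) : SimpleGraph V := SimpleGraph.fromEdgeSet (Set.range f)

theorem familyGraph_reachable {f : E → Sym2 V} {e : E} {u v : V} (h : f e = s(u, v)) :
    (familyGraph f).Reachable u v := by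
  by_cases huv : u = v
  · rw [huv]
  · exact SimpleGraph.Adj.reachable ((SimpleGraph.fromEdgeSet_adj _).2 ⟨⟨e, h⟩, huv⟩)

theorem reachable_of_adj_imp {G H : SimpleGraph V}
    (h : ∀ u v, G.Adj u v → H.Reachable u v) {u v : V} (huv : G.Reachable u v) :
    H.Reachable u v := by
  obtain ⟨p⟩ := huv
  induction p with
  | nil => rfl
  | cons hadj _ ih => exact (h _ _ hadj).trans ih

/-- In a connected edge family, an edge can be replaced by one of the other two sides of any
triangle on it, so that the family remains connected. -/
theorem exists_connected_update [DecidableEq E] {f : E → Sym2 V} (hf : (familyGraph f).Connected)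
    {e : E} {a b : V} (he : f e = s(a, b)) (c : V) :
    (familyGraph (Function.update f e s(a, c))).Connected ∨
      (familyGraph (Function.update f e s(b, c))).Connected := by
  let H : SimpleGraph V := SimpleGraph.fromEdgeSet (f '' {e}ᶜ)
  have hadj : ∀ u v, (familyGraph f).Adj u v → H.Adj u v ∨ s(u, v) = s(a, b) := by
    intro u v huv
    obtain ⟨⟨e', he'⟩, hne⟩ := (SimpleGraph.fromEdgeSet_adj _).1 huv
    by_cases h : e' = e
    · right
      rw [← he', h, he]
    · exact Or.inl ((SimpleGraph.fromEdgeSet_adj _).2 ⟨⟨e', h, he'⟩, hne⟩)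
  have hle : ∀ t, H ≤ familyGraph (Function.update f e t) := by
    intro t
    refine SimpleGraph.fromEdgeSet_mono ?_
    rintro _ ⟨e', he', rfl⟩
    exact ⟨e', Function.update_of_ne he' _ _⟩
  -- Without `e`, the vertex `c` is still joined to `a` or to `b`: follow a walk from `c` until it
  -- first meets `e`. Joining `c` to the other end then restores connectedness.
  have hreach : H.Reachable c a ∨ H.Reachable c b := by
    obtain ⟨p⟩ := hf.preconnected c a
    have key : ∀ {u v : V}, (familyGraph f).Walk u v → v = a →
        H.Reachable u a ∨ H.Reachable u b := by
      intro u v p hv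
      induction p with
      | nil => exact Or.inl (by rw [hv])
      | cons h _ ih =>
        rcases hadj _ _ h with h | h
        · exact (ih hv).imp h.reachable.trans h.reachable.trans
        · rcases Sym2.eq_iff.1 h with ⟨rfl, -⟩ | ⟨rfl, -⟩
          exacts [Or.inl .rfl, Or.inr .rfl]
    exact key p rfl
  have main : ∀ t, (familyGraph (Function.update f e t)).Reachable a b →
      (familyGraph (Function.update f e t)).Connected := by
    intro t ht
    have := hf.nonempty
    refine ⟨fun u v => reachable_of_adj_imp (fun u v huv => ?_) (hf.preconnected u v)⟩
    rcases hadj u v huv with h | h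
    · exact SimpleGraph.Adj.reachable (hle t h)
    · rcases Sym2.eq_iff.1 h with ⟨rfl, rfl⟩ | ⟨rfl, rfl⟩
      exacts [ht, ht.symm]
  rcases hreach with h | h
  · right
    refine main _ ((h.mono (hle _)).symm.trans (SimpleGraph.Reachable.symm ?_))
    exact familyGraph_reachable (Function.update_self e _ f)
  · left
    refine main _ (SimpleGraph.Reachable.trans ?_ (h.mono (hle _)))
    exact familyGraph_reachable (Function.update_self e _ f)

/-- In a connected family of `|V| - 1` edges, the distance from a root `x` differs at the two ends
of each edge, and an edge is determined by its farther end. -/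
theorem exists_height_of_connected [Finite V] [Finite E] {f : E → Sym2 V}
    (hf : (familyGraph f).Connected) (hcard : Nat.card E + 1 = Nat.card V) (x : V) :
    ∃ h : V → ℕ, h x = 0 ∧ (∀ e u v, f e = s(u, v) → h u ≠ h v) ∧
      ∀ e e' u v w, f e = s(u, v) → f e' = s(u, w) → h v ≤ h u → h w ≤ h u → e = e' := by
  classical
  let G := familyGraph f
  -- The parent edge of `v` is the first edge of a geodesic to `x`. Distinct vertices have distinct
  -- parent edges, so by `hcard` every edge is the parent edge of exactly one vertex, its farther
  -- end.
  have hex : ∀ v : {v : V // v ≠ x}, ∃ e w, f e = s(v.1, w) ∧ G.dist x w < G.dist x v.1 := by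
    intro ⟨v, hv⟩
    obtain ⟨p, hp⟩ := hf.exists_walk_length_eq_dist v x
    cases p with
    | nil => exact absurd rfl hv
    | @cons _ w _ hadj q =>
      obtain ⟨⟨e, he⟩, -⟩ := (SimpleGraph.fromEdgeSet_adj _).1 hadj
      refine ⟨e, w, he, ?_⟩
      have h₁ := SimpleGraph.dist_le q
      rw [SimpleGraph.Walk.length_cons] at hp
      rw [SimpleGraph.dist_comm (u := x), SimpleGraph.dist_comm (u := x)]
      change (familyGraph f).dist w x < (familyGraph f).dist v x
      omega
  choose par low hpar hlow using hex
  have hinj : Function.Injective par := by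
    intro v v' h
    have h₁ := hpar v
    rw [h, hpar v'] at h₁
    rcases Sym2.eq_iff.1 h₁ with ⟨h₂, -⟩ | ⟨h₂, h₃⟩
    · exact Subtype.ext h₂.symm
    · have h₄ := hlow v
      have h₅ := hlow v'
      rw [← h₂] at h₄
      rw [h₃] at h₅
      omega
  have hbij : Function.Bijective par := by
    have := Fintype.ofFinite V
    have := Fintype.ofFinite E
    refine (Fintype.bijective_iff_injective_and_card par).2 ⟨hinj, ?_⟩
    rw [Nat.card_eq_fintype_card, Nat.card_eq_fintype_card] at hcard
    rw [Fintype.card_subtype_compl, Fintype.card_subtype_eq]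
    omega
  have hend : ∀ v u w, f (par v) = s(u, w) → G.dist x w ≤ G.dist x u → v.1 = u := by
    intro v u w h hle
    rw [hpar v] at h
    rcases Sym2.eq_iff.1 h with ⟨h, -⟩ | ⟨h₁, h₂⟩
    · exact h
    · have := hlow v
      rw [h₁, h₂] at this
      omega
  refine ⟨fun v => G.dist x v, SimpleGraph.dist_self, ?_, ?_⟩
  · intro e u v he
    obtain ⟨w, rfl⟩ := hbij.2 e
    have := hlow w
    rw [hpar w] at he
    rcases Sym2.eq_iff.1 he with ⟨h₁, h₂⟩ | ⟨h₁, h₂⟩ <;> rw [h₁, h₂] at this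
    exacts [this.ne', this.ne]
  · intro e e' u v w he he' hv hw
    obtain ⟨y, rfl⟩ := hbij.2 e
    obtain ⟨y', rfl⟩ := hbij.2 e'
    rw [Subtype.ext ((hend _ _ _ he hv).trans (hend _ _ _ he' hw).symm)]

end EdgeFamily

/-! ### Reorientations with connected left graph -/

namespace LOT

variable {V E : Type*}

theorem finite_edges [Finite V] (T : LOT V E) : Finite E := Finite.of_injective _ T.ends_injective

theorem card_edges_add_one [Finite V] (T : LOT V E) : Nat.card E + 1 = Nat.card V := by
  have hrange : (SimpleGraph.fromEdgeSet (Set.range fun e => s(T.src e, T.tgt e))).edgeSet =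
      Set.range fun e => s(T.src e, T.tgt e) := by
    rw [SimpleGraph.edgeSet_fromEdgeSet, sdiff_eq_left, Set.disjoint_left]
    rintro _ ⟨e, rfl⟩ h
    exact T.src_ne_tgt e (by simpa using h)
  have h := (SimpleGraph.isTree_iff_connected_and_card.1 T.isTree).2
  rw [hrange] at h
  rwa [Nat.card_range_of_injective T.ends_injective] at h

/-- The ends of the corners of the polygons at which both edges are outgoing: the edges of the left
graph of a LOT. -/
def leftEdge (T : LOT V E) (e : E) : Sym2 V := s(T.src e, T.label e)

/-- Each LOT has a reorientation whose left graph is connected, hence a tree. -/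
theorem exists_reorientation_left_connected [Finite V] (T : LOT V E) :
    ∃ T' : LOT V E, T'.IsReorientation T ∧ (familyGraph T'.leftEdge).Connected := by
  classical
  have := T.finite_edges
  have := Fintype.ofFinite E
  -- Edges in `S` have already been moved to the left graph, the others are still tree edges; `b e`
  -- records whether `e` keeps its orientation.
  have key : ∀ S : Finset E, ∃ b : E → Bool, (familyGraph fun e =>
      if e ∈ S then s(if b e then T.src e else T.tgt e, T.label e)
      else s(T.src e, T.tgt e)).Connected := by
    intro S
    induction S using Finset.induction_on with
    | empty => exact ⟨fun _ => true, by simpa [familyGraph] using T.isTree.1⟩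
    | insert e S he ih =>
      obtain ⟨b, hb⟩ := ih
      have main : ∀ t : Bool, (Function.update (fun e =>
          if e ∈ S then s(if b e then T.src e else T.tgt e, T.label e)
          else s(T.src e, T.tgt e)) e s(if t then T.src e else T.tgt e, T.label e)) =
          fun e' => if e' ∈ insert e S then
            s(if Function.update b e t e' then T.src e' else T.tgt e', T.label e')
            else s(T.src e', T.tgt e') := by
        intro t
        ext1 e'
        by_cases h : e' = e
        · subst h
          simp
        · simp [h]
      rcases exists_connected_update hb (if_neg he) (T.label e) with h | h
      · refine ⟨Function.update b e true, ?_⟩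
        rw [← main true]
        exact h
      · refine ⟨Function.update b e false, ?_⟩
        rw [← main false]
        exact h
  obtain ⟨b, hb⟩ := key Finset.univ
  have hends : ∀ e, s(if b e then T.src e else T.tgt e, if b e then T.tgt e else T.src e) =
      s(T.src e, T.tgt e) := by
    intro e
    cases b e
    exacts [Sym2.eq_swap, rfl]
  refine ⟨{ src := fun e => if b e then T.src e else T.tgt e
            tgt := fun e => if b e then T.tgt e else T.src e
            label := T.label
            src_ne_tgt := fun e => ?_
            ends_injective := ?_
            isTree := ?_ }, ?_, ?_⟩
  · cases b e
    exacts [(T.src_ne_tgt e).symm, T.src_ne_tgt e]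
  · simpa only [hends] using T.ends_injective
  · simpa only [hends] using T.isTree
  · intro e
    refine ⟨rfl, ?_⟩
    dsimp only
    cases b e
    exacts [Or.inr ⟨rfl, rfl⟩, Or.inl ⟨rfl, rfl⟩]
  · simp only [Finset.mem_univ, if_true] at hb
    exact hb

end LOT

/-! ### Signs, sources and corners in diagrams over a LOT presentation -/

namespace SphericalDiagram

variable {V E D : Type*} {T : LOT V E} (C : SphericalDiagram T.presentation D)

/-- The sign with which the oriented edge `d` traverses the generator labelling it. -/
def sign (d : D) : Bool :=
  if C.pos d then (C.side d).letter.2 else !(C.side d).letter.2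

theorem readLetter_eq (d : D) :
    (if C.pos d then (C.side d).letter else invLetter (C.side d).letter) =
      (C.label d, C.sign d) := by
  unfold sign label invLetter
  split <;> rfl

theorem label_rev (d : D) : C.label (C.rev d) = C.label d := by
  have h := C.letter_rev d
  rw [readLetter_eq, readLetter_eq] at h
  exact (Prod.ext_iff.1 h).1

theorem sign_rev (d : D) : C.sign (C.rev d) = !C.sign d := by
  have h := C.letter_rev d
  rw [readLetter_eq, readLetter_eq] at h
  exact (Prod.ext_iff.1 h).2

end SphericalDiagram

namespace LOT

variable {V E D : Type*} {T : LOT V E}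

/-- The side of the polygon of `e` with index `i`. -/
def mkSide (T : LOT V E) (e : E) (i : Fin 4) : T.presentation.Side := ⟨e, i⟩

theorem exists_eq_mkSide (s : T.presentation.Side) : ∃ e i, s = T.mkSide e i := ⟨s.1, s.2, rfl⟩

theorem mkSide_next (e : E) (i : Fin 4) : (T.mkSide e i).next = T.mkSide e (i + 1) := by
  have : finRotate 4 i = i + 1 := finRotate_apply i
  unfold mkSide GroupPres.Side.next
  exact congrArg (Sigma.mk e) this

/-- The height of the start of a side over the lowest vertex of its polygon. -/
def sideHeight (s : T.presentation.Side) : ℝ :=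
  (![0, 1, 2, 1] : Fin 4 → ℝ) s.2

theorem sideHeight_next_sub (s : T.presentation.Side) :
    sideHeight s.next - sideHeight s = if s.letter.2 then 1 else -1 := by
  obtain ⟨e, i, rfl⟩ := exists_eq_mkSide s
  rw [mkSide_next]
  fin_cases i <;> simp [mkSide, sideHeight, GroupPres.Side.letter, presentation] <;> norm_num

/-- The cyclic sign pattern +, +, -, - passes from - to + only once. -/
theorem exists_eq_of_negative_of_next_positive {s : T.presentation.Side}
    (h : s.letter.2 = false) (h' : s.next.letter.2 = true) :
    ∃ e, s = T.mkSide e 3 ∧ s.next = T.mkSide e 0 := by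
  obtain ⟨e, i, rfl⟩ := exists_eq_mkSide s
  refine ⟨e, ?_⟩
  rw [mkSide_next] at *
  fin_cases i <;>
    simp_all [mkSide, GroupPres.Side.letter, presentation]
  exact ⟨rfl, rfl⟩

end LOT

namespace SphericalDiagram

variable {V E D : Type*} {T : LOT V E} (C : SphericalDiagram T.presentation D)

theorem exists_source [Finite D] :
    ∃ d, ∀ d', (C.next * C.rev).SameCycle d d' → C.sign d' = true := by
  have := Fintype.ofFinite D
  obtain ⟨d, hd⟩ := C.toSphereCells.exists_source (fun d => if C.sign d then 1 else -1)
    -- The height of the start of `d`. An orientation-reversed 2-cell is read backwards, so there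
    -- `d` starts at the end of its side.
    (fun d => if C.pos d then LOT.sideHeight (C.side d) else LOT.sideHeight (C.side d).next)
    (fun d => by
      rw [C.sign_rev]
      cases C.sign d <;> simp)
    (fun d => by
      rw [C.pos_next]
      cases h : C.pos d
      · have := LOT.sideHeight_next_sub (C.side d)
        simp only [sign, h, C.side_next_of_neg d h]
        cases h' : (C.side d).letter.2 <;> simp [h'] at this ⊢ <;> linarith
      · have := LOT.sideHeight_next_sub (C.side d)
        simp only [sign, h, C.side_next_of_pos d h]
        cases h' : (C.side d).letter.2 <;> simp [h'] at this ⊢ <;> linarith)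
  refine ⟨d, fun d' h => ?_⟩
  have := hd d' h
  by_contra h'
  rw [if_neg h'] at this
  linarith

/-- The corner between two successive outgoing edges. -/
theorem exists_corner {d : D} (h : C.sign d = true) (h' : C.sign (C.next (C.rev d)) = true) :
    ∃ e, C.pos (C.rev d) = true ∧ C.pos (C.next (C.rev d)) = true ∧
        C.side (C.rev d) = T.mkSide e 3 ∧ C.side (C.next (C.rev d)) = T.mkSide e 0 ∨
      C.pos (C.rev d) = false ∧ C.pos (C.next (C.rev d)) = false ∧
        C.side (C.rev d) = T.mkSide e 0 ∧ C.side (C.next (C.rev d)) = T.mkSide e 3 := by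
  have hr : C.sign (C.rev d) = false := by rw [C.sign_rev, h]; rfl
  have hp := C.pos_next (C.rev d)
  cases hpos : C.pos (C.rev d)
  · have hs := C.side_next_of_neg _ hpos
    rw [hpos] at hp
    simp only [sign, hp, hpos] at hr h'
    rw [← hs] at hr
    obtain ⟨e, h₁, h₂⟩ := LOT.exists_eq_of_negative_of_next_positive
      (s := C.side (C.next (C.rev d))) (by simpa using h') (by simpa using hr)
    exact ⟨e, Or.inr ⟨rfl, hp, hs ▸ h₂, h₁⟩⟩
  · have hs := C.side_next_of_pos _ hpos
    rw [hpos] at hp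
    simp only [sign, hp, hpos] at hr h'
    rw [hs] at h'
    obtain ⟨e, h₁, h₂⟩ := LOT.exists_eq_of_negative_of_next_positive
      (s := C.side (C.rev d)) (by simpa using hr) (by simpa using h')
    exact ⟨e, Or.inl ⟨rfl, hp, h₁, hs ▸ h₂⟩⟩

theorem label_eq_of_side_zero {d : D} {e : E} (h : C.side d = T.mkSide e 0) :
    C.label d = T.src e := by
  rw [label, h]
  rfl

theorem label_eq_of_side_three {d : D} {e : E} (h : C.side d = T.mkSide e 3) :
    C.label d = T.label e := by
  rw [label, h]
  rfl

end SphericalDiagram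

/-- A LOT presentation whose left graph is a tree is diagrammatically reducible directed away from
each of its generators. -/
theorem LOT.drAwayFrom_of_left_connected {V E : Type*} [Finite V] (T : LOT V E)
    (hT : (familyGraph T.leftEdge).Connected) (x : V) : T.presentation.DRAwayFrom {x} := by
  intro D _ C _
  have := T.finite_edges
  obtain ⟨h, hx, hne, huniq⟩ := exists_height_of_connected hT T.card_edges_add_one x
  obtain ⟨d₀, hd₀⟩ := C.exists_source
  let σ := C.next * C.rev
  have : Nonempty {d // σ.SameCycle d₀ d} := ⟨⟨d₀, Equiv.Perm.SameCycle.refl σ d₀⟩⟩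
  -- Among the edges at the source, `d` has the label farthest from `x`. The corners on its two
  -- sides, towards `c` and towards `σ d`, give the left edges `e'` and `e`; both have `C.label d`
  -- as farther end and therefore coincide.
  obtain ⟨⟨d, hd⟩, hmax⟩ := Finite.exists_max fun d : {d // σ.SameCycle d₀ d} => h (C.label d.1)
  have hmax' : ∀ d', σ.SameCycle d₀ d' → h (C.label d') ≤ h (C.label d) :=
    fun d' h' => hmax ⟨d', h'⟩
  obtain ⟨c, hc⟩ := σ.surjective d
  have hcd : σ.SameCycle d₀ c := Equiv.Perm.sameCycle_apply_right.1 (hc ▸ hd)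
  have hdn : σ.SameCycle d₀ (C.next (C.rev d)) := Equiv.Perm.sameCycle_apply_right (f := σ).2 hd
  have hc' : C.next (C.rev c) = d := hc
  obtain ⟨e, he⟩ := C.exists_corner (hd₀ d hd) (hd₀ _ hdn)
  obtain ⟨e', he'⟩ := C.exists_corner (hd₀ c hcd) (hc' ▸ hd₀ d hd)
  rw [hc'] at he'
  have hE : T.leftEdge e = s(C.label d, C.label (C.next (C.rev d))) := by
    rw [← C.label_rev d]
    rcases he with ⟨-, -, h₁, h₂⟩ | ⟨-, -, h₁, h₂⟩
    · rw [C.label_eq_of_side_three h₁, C.label_eq_of_side_zero h₂, leftEdge, Sym2.eq_swap]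
    · rw [C.label_eq_of_side_zero h₁, C.label_eq_of_side_three h₂, leftEdge]
  have hE' : T.leftEdge e' = s(C.label d, C.label c) := by
    rw [← C.label_rev c]
    rcases he' with ⟨-, -, h₁, h₂⟩ | ⟨-, -, h₁, h₂⟩
    · rw [C.label_eq_of_side_three h₁, C.label_eq_of_side_zero h₂, leftEdge]
    · rw [C.label_eq_of_side_zero h₁, C.label_eq_of_side_three h₂, leftEdge, Sym2.eq_swap]
  obtain rfl := huniq e e' _ _ _ hE hE' (hmax' _ hdn) (hmax' _ hcd)
  have hloop : T.src e ≠ T.label e := fun hl => hne e _ _ rfl (congrArg h hl)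
  refine ⟨d, ?_, ?_⟩
  · have hl := C.label_rev d
    -- If both 2-cells had the same orientation, the edge would be side 3 of one and side 0 of the
    -- other, making `e` a loop of the left graph. Otherwise they are mirror images.
    rcases he with ⟨p₁, -, h₁, -⟩ | ⟨p₁, -, h₁, -⟩ <;>
      rcases he' with ⟨-, p₂, -, h₂⟩ | ⟨-, p₂, -, h₂⟩
    · rw [C.label_eq_of_side_three h₁, C.label_eq_of_side_zero h₂] at hl
      exact absurd hl.symm hloop
    · exact ⟨h₁.trans h₂.symm, by simp [p₁, p₂]⟩
    · exact ⟨h₁.trans h₂.symm, by simp [p₁, p₂]⟩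
    · rw [C.label_eq_of_side_zero h₁, C.label_eq_of_side_three h₂] at hl
      exact absurd hl hloop
  -- If the farthest label were `x`, the label of `c` would also have height 0, but the ends of a
  -- left edge have different heights.
  · rintro (hdx : C.label d = x)
    have h₁ := hmax' _ hcd
    have h₂ := hne e _ _ hE'
    rw [hdx, hx] at h₁ h₂
    omega

theorem mainTheorem12 {V E : Type*} [Finite V] (T : LOT V E) :
    ∃ T' : LOT V E, T'.IsReorientation T ∧
      ∀ x : V, T'.presentation.DRAwayFrom {x} := by
  obtain ⟨T', hT', hconn⟩ := T.exists_reorientation_left_connected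
  exact ⟨T', hT', T'.drAwayFrom_of_left_connected hconn⟩
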